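/- **Proposition 1.14.** Let $K$ be an infinite field, let $E=K((X,Y))=\mathrm{Quot}(K[[X,Y]])$, and let $v$ be the discrete valuation of $E$ extending the order function of the maximal ideal $\langle X,Y\rangle$ of $K[[X,Y]]$. Let $\hat E$ be the completion of $E$ with respect to $v$. Let $I$ be a finite set and let $c_i\in K$ ($i\in I$) be pairwise distinct. For $i\in I$ put $z_i=\frac{Y}{X-c_iY}\in E$. For $J\subseteq I$ let $D_J\subseteq\hat E$ be the completion (that is, the closure in $\hat E$) of the subring $K[z_j\mid j\in J][X,Y]$ of $E$ with respect to $v$. Let $Q=\mathrm{Quot}(D_I)\subseteq\hat E$. For $i\in I$ let $Q_i=E\cdot D_{I\smallsetminus\{i\}}$ be the subring of $\hat E$ generated by $E$ and $D_{I\smallsetminus\{i\}}$, and let $Q_i'=\bigcap_{j\in I,\,j\neq i}Q_j$, the intersection being taken inside $Q$ (so that $Q_i'=Q$ if $I=\{i\}$). Then for each $i\in I$, each $n\in\mathbb N$ and each $b\in\mathrm{GL}_n(Q)$ there exist $b_1\in\mathrm{GL}_n(Q_i)$ and $b_2\in\mathrm{GL}_n(Q_i')$ such that $b=b_1b_2$.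 -/

import Mathlib

open scoped WithZero

noncomputable section

namespace AnalyticPatching

variable (K : Type*) [Field K]

/-- The ring `K[[X, Y]]` of formal power series in two variables. -/
abbrev PS : Type _ := MvPowerSeries (Fin 2) K

/-- The field `E = K((X, Y)) = Quot(K[[X, Y]])`. -/
abbrev E : Type _ := FractionRing (PS K)

/-- The order function of the maximal ideal `⟨X, Y⟩` of `K[[X, Y]]`, written multiplicatively: a
nonzero power series whose nonzero homogeneous component of lowest degree has degree `m` (that is,
which lies in `⟨X, Y⟩ ^ m` but not in `⟨X, Y⟩ ^ (m + 1)`) is sent to `exp (-m)`, and `0` is sent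
to `0`. -/
def orderValuation : Valuation (PS K) ℤᵐ⁰ := by
  classical
  exact
  { toFun := fun f => if f = 0 then 0 else WithZero.exp (-(f.order.toNat : ℤ))
    map_zero' := if_pos rfl
    map_one' := by
      have h : (1 : PS K).order = 0 := by
        have := MvPowerSeries.order_monomial_of_ne_zero (σ := Fin 2) (R := K) (d := 0)
          (a := (1 : K)) one_ne_zero
        simpa using this
      rw [if_neg one_ne_zero, h]
      simp
    map_mul' := fun f g => by
      by_cases hf : f = 0
      · simp [hf]
      by_cases hg : g = 0
      · simp [hg]
      have hf' : f.order ≠ ⊤ := fun h => hf (MvPowerSeries.order_eq_top_iff.1 h)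
      have hg' : g.order ≠ ⊤ := fun h => hg (MvPowerSeries.order_eq_top_iff.1 h)
      rw [if_neg (mul_ne_zero hf hg), if_neg hf, if_neg hg, MvPowerSeries.order_mul,
        ENat.toNat_add hf' hg', ← WithZero.exp_add]
      congr 1
      push_cast
      ring
    map_add_le_max' := fun f g => by
      by_cases hf : f = 0
      · simp [hf]
      by_cases hg : g = 0
      · simp [hg]
      by_cases hfg : f + g = 0
      · simp [hfg]
      have hfg' : (f + g).order ≠ ⊤ := fun h => hfg (MvPowerSeries.order_eq_top_iff.1 h)
      rw [if_neg hfg, if_neg hf, if_neg hg, le_max_iff]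
      have h := MvPowerSeries.min_order_le_add (f := f) (g := g)
      rcases min_le_iff.1 h with h | h
      · left
        have := ENat.toNat_le_toNat h hfg'
        rw [WithZero.exp_le_exp]
        omega
      · right
        have := ENat.toNat_le_toNat h hfg'
        rw [WithZero.exp_le_exp]
        omega }

theorem orderValuation_apply_of_ne_zero {f : PS K} (hf : f ≠ 0) :
    orderValuation K f = WithZero.exp (-(f.order.toNat : ℤ)) := by
  classical
  exact if_neg hf

theorem nonZeroDivisors_le_primeCompl :
    nonZeroDivisors (PS K) ≤ (orderValuation K).supp.primeCompl := by
  intro f hf h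
  rw [SetLike.mem_coe, Valuation.mem_supp_iff,
    orderValuation_apply_of_ne_zero K (nonZeroDivisors.ne_zero hf)] at h
  exact WithZero.exp_ne_zero h

/-- The discrete valuation `v` of `E` extending the order function of `K[[X, Y]]`. -/
def v : Valuation (E K) ℤᵐ⁰ :=
  (orderValuation K).extendToLocalization (nonZeroDivisors_le_primeCompl K) (E K)

/-- The completion of the field `E` with respect to `v`. All the rings below are subrings of this
field. -/
abbrev EHat : Type _ := (v K).Completion

/-- The canonical embedding of `E` in its completion. -/
def toEHat : E K →+* EHat K :=
  (UniformSpace.Completion.coeRingHom : WithVal (v K) →+* EHat K).comp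
    ((WithVal.equiv (v K)).symm : E K →+* WithVal (v K))

/-- The element `X` of `E`. -/
def X : E K := algebraMap (PS K) (E K) (MvPowerSeries.X 0)

/-- The element `Y` of `E`. -/
def Y : E K := algebraMap (PS K) (E K) (MvPowerSeries.X 1)

variable {K} {I : Type*} (c : I → K)

/-- The element `z_i = Y / (X - c_i Y)` of `E`. -/
def z (i : I) : E K := Y K / (X K - algebraMap K (E K) (c i) * Y K)

/-- The subring `K[z_j | j ∈ J][X, Y]` of `E`. -/
def polyRing (J : Set I) : Subalgebra K (E K) :=
  Algebra.adjoin K (z c '' J ∪ {X K, Y K})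

/-- The ring `D_J`: the completion of `K[z_j | j ∈ J][X, Y]` with respect to `v`, realized as its
closure in the completion of `E`. -/
def D (J : Set I) : Subring (EHat K) :=
  ((polyRing c J).toSubring.map (toEHat K)).topologicalClosure

/-- The field `Q = Quot(D_I)`, that is, the field of all quotients of elements of `D_I`. -/
def Q : Subfield (EHat K) := Subfield.closure (D c Set.univ : Set (EHat K))

/-- The ring `Q_i = E ⬝ D_{I ∖ {i}}`: the subring generated by `E` and `D_{I ∖ {i}}`. -/
def Qi (i : I) : Subring (EHat K) := (toEHat K).range ⊔ D c {i}ᶜ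

/-- The ring `Q'_i`: the intersection, inside `Q`, of the rings `Q_j` for `j ≠ i`. If there is no
such `j` it is `Q`. -/
def Qi' (i : I) : Subring (EHat K) := (Q c).toSubring ⊓ ⨅ j ∈ ({i}ᶜ : Set I), Qi c j

end AnalyticPatching

end

/-! Every `z_j = 1/(X/Y - c_j)` lies in `K(X/Y)`, where `v` is trivial, and `Y = z_i (X - c_i Y)`.
Write `R_J = K[z_j | j ∈ J]`. Substituting `T = X - c_i Y` embeds `R_J[[T]]` in `D_J`, and onto
`D_J` when `i ∈ J` (`evalLin_injective`, `evalLin_mem_D`, `D_le_range_evalLin`). So the problem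
becomes one about matrices of power series in `T`.

Partial fractions give `R_I = R_{I∖{i}} + R_{{i}}` (`exists_partialFractions`). Solving for
coefficients one degree at a time, a matrix over `R_I[[T]]` congruent to `1` modulo `T` factors into
one over `R_{I∖{i}}[[T]]` and one over `R_{{i}}[[T]]` (`exists_matrix_factorization`). The values of
the factors have entries in `D_{I∖{i}} ⊆ Q_i` and in `D_{{i}} ⊆ Q_i'`.

It remains to write `b` as a matrix over `E` times the value of a matrix congruent to `1`
(`exists_eq_map_toEHat_mul`). For nonzero `d ∈ R_I` the quotient `R_I/(d)` is finite-dimensional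
over `K`, so division by a power series leaves remainders with coefficients in a finite-dimensional
`K`-space. Such remainders have values in `E`, because `K[[T]]` is sent into `K[[X, Y]]`. Hence
everything is congruent to an element of `E` modulo `T δ`, for any `δ ≠ 0` (`exists_approx`); `δ =
det B` handles a numerator matrix `B` of `b`, and `δ = d` its denominator. -/

open scoped WithZero

noncomputable section

namespace AnalyticPatching

/-! ### Topology of the completion in terms of its valuation -/

section

variable (K : Type*) [Field K]

/-- The valuation of the completion of `E`. -/
def hatV : Valuation (EHat K) ℤᵐ⁰ := Valued.v

variable {K}

theorem hatV_toEHat (e : E K) : hatV K (toEHat K e) = v K e :=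
  Valued.valuedCompletion_apply (K := WithVal (v K)) (WithVal.toVal (v K) e)

theorem v_algebraMap (f : PS K) : v K (algebraMap (PS K) (E K) f) = orderValuation K f :=
  Valuation.extendToLocalization_apply_map_apply _ _ _ _

theorem orderValuation_le_iff (f : PS K) (n : ℕ) :
    orderValuation K f ≤ WithZero.exp (-(n : ℤ)) ↔ (n : ℕ∞) ≤ f.order := by
  by_cases hf : f = 0
  · simp [hf]
  · rw [orderValuation_apply_of_ne_zero K hf, WithZero.exp_le_exp, neg_le_neg_iff, Nat.cast_le,
      ← MvPowerSeries.ne_zero_iff_order_finite.1 hf]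
    simp

theorem orderValuation_X (s : Fin 2) :
    orderValuation K (MvPowerSeries.X s) = WithZero.exp (-1 : ℤ) := by
  have h : (MvPowerSeries.X s : PS K).order = 1 := by
    rw [MvPowerSeries.X, MvPowerSeries.order_monomial_of_ne_zero one_ne_zero]
    simp
  have h0 : (MvPowerSeries.X s : PS K) ≠ 0 := by
    intro h0
    simp [h0] at h
  rw [orderValuation_apply_of_ne_zero K h0, h]
  simp

theorem v_Y : v K (Y K) = WithZero.exp (-1 : ℤ) := by
  rw [Y, v_algebraMap, orderValuation_X]

theorem Y_ne_zero : Y K ≠ 0 := by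
  intro h
  have := v_Y (K := K)
  rw [h, map_zero] at this
  exact WithZero.exp_ne_zero this.symm

theorem eq_zero_of_forall_hatV_le {x : EHat K} (h : ∀ n : ℕ, hatV K x ≤ WithZero.exp (-(n : ℤ))) :
    x = 0 := by
  by_contra hx
  have h0 : hatV K x ≠ 0 := (Valuation.ne_zero_iff _).2 hx
  have h1 := h ((1 - WithZero.log (hatV K x)).toNat)
  rw [← WithZero.log_le_iff_le_exp h0] at h1
  omega

theorem mem_nhds_iff_hatV {s : Set (EHat K)} {x : EHat K} :
    s ∈ nhds x ↔ ∃ n : ℕ, {y | hatV K (y - x) ≤ WithZero.exp (-(n : ℤ))} ⊆ s := by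
  refine (Valued.mem_nhds (R := EHat K) (Γ₀ := ℤᵐ⁰)).trans ?_
  constructor
  · rintro ⟨γ, hγ⟩
    have h0 := MonoidWithZeroHom.ValueGroup₀.embedding_unit_ne_zero γ
    refine ⟨(1 - WithZero.log (MonoidWithZeroHom.ValueGroup₀.embedding γ.1)).toNat, fun y hy => hγ ?_⟩
    change Valued.v.restrict (y - x) < γ.1
    rw [Valuation.restrict_lt_iff_lt_embedding]
    refine lt_of_le_of_lt hy ?_
    rw [← WithZero.lt_log_iff_exp_lt h0]
    omega
  · rintro ⟨n, hn⟩
    -- Basic neighbourhoods are indexed by the actual value group; `Y ^ n` shows that `exp (-n)`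
    -- belongs to it.
    have hY : hatV K (toEHat K (Y K ^ n)) = WithZero.exp (-(n : ℤ)) := by
      rw [hatV_toEHat, map_pow, v_Y, ← WithZero.exp_nsmul]
      simp
    have h0 : (Valued.v.restrict (toEHat K (Y K ^ n))) ≠ 0 := by
      rw [Ne, Valuation.restrict_eq_zero_iff]
      change ¬ hatV K _ = 0
      rw [hY]
      exact WithZero.exp_ne_zero
    refine ⟨Units.mk0 _ h0, fun y hy => hn ?_⟩
    have hy' : Valued.v.restrict (y - x) < Valued.v.restrict (toEHat K (Y K ^ n)) := hy
    rw [Valuation.restrict_lt_iff] at hy'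
    change hatV K _ ≤ _
    rw [← hY]
    exact hy'.le

theorem mem_closure_iff_hatV {s : Set (EHat K)} {x : EHat K} :
    x ∈ closure s ↔ ∀ n : ℕ, ∃ y ∈ s, hatV K (x - y) ≤ WithZero.exp (-(n : ℤ)) := by
  rw [mem_closure_iff_nhds]
  constructor
  · intro h n
    obtain ⟨y, hy, hys⟩ := h _ (mem_nhds_iff_hatV.2 ⟨n, subset_rfl⟩)
    exact ⟨y, hys, by rw [Valuation.map_sub_swap]; exact hy⟩
  · intro h t ht
    obtain ⟨n, hn⟩ := mem_nhds_iff_hatV.1 ht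
    obtain ⟨y, hys, hy⟩ := h n
    exact ⟨y, hn (by rw [Valuation.map_sub_swap] at hy; exact hy), hys⟩

theorem hatV_sub_le_of_le {x : ℕ → EHat K}
    (hx : ∀ n : ℕ, hatV K (x (n + 1) - x n) ≤ WithZero.exp (-(n : ℤ))) {n m : ℕ} (h : n ≤ m) :
    hatV K (x m - x n) ≤ WithZero.exp (-(n : ℤ)) := by
  induction m, h using Nat.le_induction with
  | base => simp
  | succ m hm ih =>
    have : x (m + 1) - x n = (x (m + 1) - x m) + (x m - x n) := by ring
    rw [this]
    refine Valuation.map_add_le _ ((hx m).trans ?_) ih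
    rw [WithZero.exp_le_exp]
    omega

theorem exists_hatV_limit (x : ℕ → EHat K)
    (hx : ∀ n : ℕ, hatV K (x (n + 1) - x n) ≤ WithZero.exp (-(n : ℤ))) :
    ∃ y, ∀ n : ℕ, hatV K (y - x n) ≤ WithZero.exp (-(n : ℤ)) := by
  have hc : CauchySeq x := by
    refine (Valued.cauchy_iff (R := EHat K) (Γ₀ := ℤᵐ⁰)).2 ⟨inferInstance, fun γ => ?_⟩
    have h0 := MonoidWithZeroHom.ValueGroup₀.embedding_unit_ne_zero γ
    obtain ⟨N, hN⟩ : ∃ N : ℕ, WithZero.exp (-(N : ℤ)) <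
        MonoidWithZeroHom.ValueGroup₀.embedding γ.1 := by
      refine ⟨(1 - WithZero.log (MonoidWithZeroHom.ValueGroup₀.embedding γ.1)).toNat, ?_⟩
      rw [← WithZero.lt_log_iff_exp_lt h0]
      omega
    refine ⟨x '' Set.Ici N, Filter.image_mem_map (Filter.Ici_mem_atTop N), ?_⟩
    rintro _ ⟨a, ha, rfl⟩ _ ⟨b, hb, rfl⟩
    rw [Valuation.restrict_lt_iff_lt_embedding]
    refine lt_of_le_of_lt ?_ hN
    change hatV K _ ≤ _
    have : x b - x a = (x b - x N) - (x a - x N) := by ring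
    rw [this]
    exact Valuation.map_sub_le _ (hatV_sub_le_of_le hx hb) (hatV_sub_le_of_le hx ha)
  obtain ⟨y, hy⟩ := cauchySeq_tendsto_of_complete hc
  refine ⟨y, fun n => ?_⟩
  have := hy (mem_nhds_iff_hatV.2 ⟨n, subset_rfl⟩)
  obtain ⟨m, hm⟩ := (Filter.mem_atTop_sets.1 this)
  have h1 : hatV K (x (max m n) - y) ≤ WithZero.exp (-(n : ℤ)) := hm _ (le_max_left _ _)
  have h2 := hatV_sub_le_of_le hx (le_max_right m n)
  have : y - x n = (x (max m n) - x n) - (x (max m n) - y) := by ring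
  rw [this]
  exact Valuation.map_sub_le _ h2 h1

end

/-! ### Evaluation of power series in the completion -/

section

variable {K : Type*} [Field K] {R : Type*} [CommRing R]

/-- `x` is the value at `τ` of the power series `f`, whose coefficients are mapped to the
completion of `E` by `ι`. -/
def IsValue (ι : R →+* EHat K) (τ : EHat K) (f : PowerSeries R) (x : EHat K) : Prop :=
  ∀ n : ℕ, ∃ p : Polynomial R, PowerSeries.X ^ n ∣ f - (p : PowerSeries R) ∧
    hatV K (x - p.eval₂ ι τ) ≤ WithZero.exp (-(n : ℤ))

section

variable {ι : R →+* EHat K} {τ : EHat K}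

theorem hatV_pow_le (hτ : hatV K τ ≤ WithZero.exp (-1 : ℤ)) (n : ℕ) :
    hatV K (τ ^ n) ≤ WithZero.exp (-(n : ℤ)) := by
  have := pow_le_pow_left' hτ n
  rwa [← map_pow, ← WithZero.exp_nsmul, show n • (-1 : ℤ) = -(n : ℤ) by simp] at this

theorem exp_neg_natCast_le_one (n : ℕ) : WithZero.exp (-(n : ℤ)) ≤ (1 : ℤᵐ⁰) := by
  rw [← WithZero.exp_zero, WithZero.exp_le_exp]
  omega

theorem hatV_eval₂_le (hι : ∀ r, hatV K (ι r) ≤ 1) (hτ : hatV K τ ≤ WithZero.exp (-1 : ℤ))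
    (p : Polynomial R) : hatV K (p.eval₂ ι τ) ≤ 1 := by
  rw [Polynomial.eval₂_eq_sum_range]
  refine Valuation.map_sum_le _ fun k _ => ?_
  rw [map_mul]
  exact mul_le_one' (hι _) ((hatV_pow_le hτ k).trans (exp_neg_natCast_le_one k))

theorem hatV_eval₂_le_of_dvd (hι : ∀ r, hatV K (ι r) ≤ 1)
    (hτ : hatV K τ ≤ WithZero.exp (-1 : ℤ)) {p : Polynomial R} {n : ℕ}
    (h : PowerSeries.X ^ n ∣ (p : PowerSeries R)) :
    hatV K (p.eval₂ ι τ) ≤ WithZero.exp (-(n : ℤ)) := by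
  have h' : Polynomial.X ^ n ∣ p := by
    rw [Polynomial.X_pow_dvd_iff]
    intro d hd
    rw [← Polynomial.coeff_coe]
    exact PowerSeries.X_pow_dvd_iff.1 h d hd
  obtain ⟨q, rfl⟩ := h'
  rw [Polynomial.eval₂_mul, Polynomial.eval₂_X_pow, map_mul]
  exact (mul_le_mul' (hatV_pow_le hτ n) (hatV_eval₂_le hι hτ q)).trans_eq (mul_one _)
theorem X_pow_dvd_sub_trunc (f : PowerSeries R) (n : ℕ) :
    PowerSeries.X ^ n ∣ f - (PowerSeries.trunc n f : PowerSeries R) := by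
  rw [PowerSeries.X_pow_dvd_iff]
  intro m hm
  rw [map_sub, PowerSeries.coeff_coe_trunc_of_lt hm, sub_self]

theorem IsValue.hatV_le (hι : ∀ r, hatV K (ι r) ≤ 1) (hτ : hatV K τ ≤ WithZero.exp (-1 : ℤ))
    {f : PowerSeries R} {x : EHat K} (h : IsValue ι τ f x) : hatV K x ≤ 1 := by
  obtain ⟨p, -, hp⟩ := h 0
  rw [← sub_add_cancel x (p.eval₂ ι τ)]
  exact Valuation.map_add_le _ (hp.trans (exp_neg_natCast_le_one 0)) (hatV_eval₂_le hι hτ p)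

/-- Two polynomials that agree with `f` modulo `X ^ n` have values within `exp (-n)` of each other.
Uniqueness turns the ring homomorphism laws of `evalPS`, which is defined by choice, into closure
properties of `IsValue`. -/
theorem IsValue.unique (hι : ∀ r, hatV K (ι r) ≤ 1) (hτ : hatV K τ ≤ WithZero.exp (-1 : ℤ))
    {f : PowerSeries R} {x y : EHat K} (hx : IsValue ι τ f x) (hy : IsValue ι τ f y) : x = y := by
  rw [← sub_eq_zero]
  refine eq_zero_of_forall_hatV_le fun n => ?_
  obtain ⟨p, hp, hxp⟩ := hx n
  obtain ⟨q, hq, hyq⟩ := hy n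
  have h1 : PowerSeries.X ^ n ∣ ((p - q : Polynomial R) : PowerSeries R) := by
    have := dvd_sub hq hp
    rw [Polynomial.coe_sub]
    convert this using 1
    ring
  have h2 := hatV_eval₂_le_of_dvd hι hτ h1
  rw [Polynomial.eval₂_sub] at h2
  have : x - y = (x - p.eval₂ ι τ) - (y - q.eval₂ ι τ) + (p.eval₂ ι τ - q.eval₂ ι τ) := by ring
  rw [this]
  exact Valuation.map_add_le _ (Valuation.map_sub_le _ hxp hyq) h2

theorem isValue_coe (p : Polynomial R) : IsValue ι τ (p : PowerSeries R) (p.eval₂ ι τ) :=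
  fun n => ⟨p, by simp, by simp⟩

theorem IsValue.add {f g : PowerSeries R} {x y : EHat K} (hx : IsValue ι τ f x)
    (hy : IsValue ι τ g y) : IsValue ι τ (f + g) (x + y) := by
  intro n
  obtain ⟨p, hp, hxp⟩ := hx n
  obtain ⟨q, hq, hyq⟩ := hy n
  refine ⟨p + q, ?_, ?_⟩
  · have := dvd_add hp hq
    rw [Polynomial.coe_add]
    convert this using 1
    ring
  · have : x + y - (p + q).eval₂ ι τ = (x - p.eval₂ ι τ) + (y - q.eval₂ ι τ) := by
      rw [Polynomial.eval₂_add]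
      ring
    rw [this]
    exact Valuation.map_add_le _ hxp hyq

theorem IsValue.mul (hι : ∀ r, hatV K (ι r) ≤ 1) (hτ : hatV K τ ≤ WithZero.exp (-1 : ℤ))
    {f g : PowerSeries R} {x y : EHat K} (hx : IsValue ι τ f x)
    (hy : IsValue ι τ g y) : IsValue ι τ (f * g) (x * y) := by
  intro n
  obtain ⟨p, hp, hxp⟩ := hx n
  obtain ⟨q, hq, hyq⟩ := hy n
  refine ⟨p * q, ?_, ?_⟩
  · have := dvd_add (hq.mul_left f) (hp.mul_right (q : PowerSeries R))
    rw [Polynomial.coe_mul]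
    convert this using 1
    ring
  · have : x * y - (p * q).eval₂ ι τ =
        (y - q.eval₂ ι τ) * x + (x - p.eval₂ ι τ) * q.eval₂ ι τ := by
      rw [Polynomial.eval₂_mul]
      ring
    rw [this]
    refine Valuation.map_add_le _ ?_ ?_ <;> rw [map_mul]
    · exact (mul_le_mul' hyq (hx.hatV_le hι hτ)).trans_eq (mul_one _)
    · exact (mul_le_mul' hxp (hatV_eval₂_le hι hτ q)).trans_eq (mul_one _)
theorem exists_isValue (hι : ∀ r, hatV K (ι r) ≤ 1) (hτ : hatV K τ ≤ WithZero.exp (-1 : ℤ))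
    (f : PowerSeries R) : ∃ x, IsValue ι τ f x := by
  obtain ⟨y, hy⟩ := exists_hatV_limit (fun n => (PowerSeries.trunc n f).eval₂ ι τ) (fun n => by
    rw [← Polynomial.eval₂_sub]
    refine hatV_eval₂_le_of_dvd hι hτ ?_
    have h1 := (pow_dvd_pow PowerSeries.X (Nat.le_succ n)).trans (X_pow_dvd_sub_trunc f (n + 1))
    have := dvd_sub (X_pow_dvd_sub_trunc f n) h1
    rw [Polynomial.coe_sub]
    convert this using 1
    ring)
  exact ⟨y, fun n => ⟨_, X_pow_dvd_sub_trunc f n, hy n⟩⟩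

end

variable (ι : R →+* EHat K) (τ : EHat K) (hι : ∀ r, hatV K (ι r) ≤ 1)
  (hτ : hatV K τ ≤ WithZero.exp (-1 : ℤ))

/-- Evaluation of power series at an element of positive valuation of the completion of `E`. -/
def evalPS : PowerSeries R →+* EHat K where
  toFun f := (exists_isValue hι hτ f).choose
  map_zero' := (exists_isValue hι hτ 0).choose_spec.unique hι hτ (by
    simpa using isValue_coe (ι := ι) (τ := τ) (0 : Polynomial R))
  map_one' := (exists_isValue hι hτ 1).choose_spec.unique hι hτ (by
    simpa using isValue_coe (ι := ι) (τ := τ) (1 : Polynomial R))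
  map_add' f g := (exists_isValue hι hτ (f + g)).choose_spec.unique hι hτ
    ((exists_isValue hι hτ f).choose_spec.add (exists_isValue hι hτ g).choose_spec)
  map_mul' f g := (exists_isValue hι hτ (f * g)).choose_spec.unique hι hτ
    ((exists_isValue hι hτ f).choose_spec.mul hι hτ (exists_isValue hι hτ g).choose_spec)

theorem isValue_evalPS (f : PowerSeries R) : IsValue ι τ f (evalPS ι τ hι hτ f) :=
  (exists_isValue hι hτ f).choose_spec

variable {ι τ}

theorem IsValue.evalPS_eq {f : PowerSeries R} {x : EHat K} (h : IsValue ι τ f x) :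
    evalPS ι τ hι hτ f = x :=
  (isValue_evalPS ι τ hι hτ f).unique hι hτ h

theorem evalPS_coe (p : Polynomial R) :
    evalPS ι τ hι hτ (p : PowerSeries R) = p.eval₂ ι τ :=
  (isValue_coe p).evalPS_eq hι hτ

theorem evalPS_C (r : R) : evalPS ι τ hι hτ (PowerSeries.C r) = ι r := by
  rw [← Polynomial.coe_C, evalPS_coe, Polynomial.eval₂_C]

theorem evalPS_X : evalPS ι τ hι hτ PowerSeries.X = τ := by
  rw [← Polynomial.coe_X, evalPS_coe, Polynomial.eval₂_X]

theorem hatV_evalPS_le_one (f : PowerSeries R) : hatV K (evalPS ι τ hι hτ f) ≤ 1 :=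
  (isValue_evalPS ι τ hι hτ f).hatV_le hι hτ

theorem hatV_evalPS_le {f : PowerSeries R} {n : ℕ} (h : PowerSeries.X ^ n ∣ f) :
    hatV K (evalPS ι τ hι hτ f) ≤ WithZero.exp (-(n : ℤ)) := by
  obtain ⟨g, rfl⟩ := h
  rw [map_mul, map_pow, evalPS_X, map_mul]
  exact (mul_le_mul' (hatV_pow_le hτ n) (hatV_evalPS_le_one hι hτ g)).trans_eq (mul_one _)
theorem hatV_evalPS_eq_one {f : PowerSeries R}
    (hf : hatV K (ι (PowerSeries.constantCoeff f)) = 1) :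
    hatV K (evalPS ι τ hι hτ f) = 1 := by
  have h : PowerSeries.X ^ 1 ∣ f - PowerSeries.C (PowerSeries.constantCoeff f) := by
    rw [pow_one, PowerSeries.X_dvd_iff]
    simp
  have h1 := hatV_evalPS_le hι hτ h
  rw [map_sub, evalPS_C] at h1
  rw [← hf]
  refine Valuation.map_eq_of_sub_lt _ (lt_of_le_of_lt h1 ?_)
  rw [hf, ← WithZero.exp_zero, WithZero.exp_lt_exp]
  simp

/-- If the valuation is trivial on the coefficients, then the valuation of a value is determined by
the order of the power series. -/
theorem X_pow_dvd_of_hatV_evalPS_le (hι1 : ∀ r, r ≠ 0 → hatV K (ι r) = 1)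
    (hτ1 : hatV K τ = WithZero.exp (-1 : ℤ)) {f : PowerSeries R} {n : ℕ}
    (h : hatV K (evalPS ι τ hι hτ f) ≤ WithZero.exp (-(n : ℤ))) : PowerSeries.X ^ n ∣ f := by
  by_contra hn
  have hf : f ≠ 0 := by
    rintro rfl
    exact hn (dvd_zero _)
  -- Write `f = X ^ k * g` with `g` of nonzero constant coefficient: the value of `g` has valuation
  -- `1`, so that of `f` has valuation exactly `exp (-k)`.
  obtain ⟨k, hk⟩ := ENat.ne_top_iff_exists.1 (mt PowerSeries.order_eq_top.1 hf)
  obtain ⟨g, hg⟩ := PowerSeries.X_pow_order_dvd (φ := f)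
  rw [← hk, ENat.toNat_natCast] at hg
  have hkn : k < n := by
    by_contra hkn
    exact hn ((pow_dvd_pow _ (not_lt.1 hkn)).trans ⟨g, hg⟩)
  have hg0 : PowerSeries.constantCoeff g ≠ 0 := by
    have := PowerSeries.coeff_order hf
    rw [← hk, ENat.toNat_natCast, hg, PowerSeries.coeff_X_pow_mul'] at this
    simpa using this
  rw [hg, map_mul, map_mul, hatV_evalPS_eq_one hι hτ (hι1 _ hg0), map_pow, evalPS_X, map_pow, hτ1,
    mul_one, ← WithZero.exp_nsmul, WithZero.exp_le_exp] at h
  simp at h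
  omega

theorem evalPS_injective (hι1 : ∀ r, r ≠ 0 → hatV K (ι r) = 1)
    (hτ1 : hatV K τ = WithZero.exp (-1 : ℤ)) : Function.Injective (evalPS ι τ hι hτ) := by
  rw [injective_iff_map_eq_zero]
  intro f hf
  ext n
  have : PowerSeries.X ^ (n + 1) ∣ f :=
    X_pow_dvd_of_hatV_evalPS_le hι hτ hι1 hτ1 (by rw [hf]; simp)
  simpa using PowerSeries.X_pow_dvd_iff.1 this n (Nat.lt_succ_self n)

/-- Since valuation detects order, series whose values converge also converge `X`-adically, and the
limit series has the limit value. -/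
theorem isClosed_range_evalPS (hι1 : ∀ r, r ≠ 0 → hatV K (ι r) = 1)
    (hτ1 : hatV K τ = WithZero.exp (-1 : ℤ)) :
    IsClosed ((evalPS ι τ hι hτ).range : Set (EHat K)) := by
  refine isClosed_of_closure_subset fun x hx => ?_
  rw [mem_closure_iff_hatV] at hx
  have hx' : ∀ n : ℕ, ∃ f, hatV K (x - evalPS ι τ hι hτ f) ≤ WithZero.exp (-(n : ℤ)) := by
    intro n
    obtain ⟨_, ⟨f, rfl⟩, hf⟩ := hx n
    exact ⟨f, hf⟩
  choose f hf using hx'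
  have hd : ∀ n m, n ≤ m → PowerSeries.X ^ n ∣ f m - f n := by
    intro n m hnm
    refine X_pow_dvd_of_hatV_evalPS_le hι hτ hι1 hτ1 ?_
    rw [map_sub]
    have : evalPS ι τ hι hτ (f m) - evalPS ι τ hι hτ (f n) =
      (x - evalPS ι τ hι hτ (f n)) - (x - evalPS ι τ hι hτ (f m)) := by ring
    rw [this]
    refine Valuation.map_sub_le _ (hf n) ((hf m).trans ?_)
    rw [WithZero.exp_le_exp]
    omega
  -- The `n`-th coefficient is stable from `f (n + 1)` on, as later terms agree with it modulo `X ^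
  -- (n + 1)`.
  refine ⟨PowerSeries.mk fun n => PowerSeries.coeff n (f (n + 1)), ?_⟩
  rw [eq_comm, ← sub_eq_zero]
  refine eq_zero_of_forall_hatV_le fun n => ?_
  have h1 : PowerSeries.X ^ n ∣
      (PowerSeries.mk fun n => PowerSeries.coeff n (f (n + 1))) - f n := by
    rw [PowerSeries.X_pow_dvd_iff]
    intro m hm
    rw [map_sub, PowerSeries.coeff_mk]
    have := PowerSeries.X_pow_dvd_iff.1 (hd (m + 1) n hm) m (Nat.lt_succ_self m)
    rw [map_sub, sub_eq_zero] at this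
    rw [this, sub_self]
  have h2 := hatV_evalPS_le hι hτ h1
  rw [map_sub] at h2
  set y := evalPS ι τ hι hτ (PowerSeries.mk fun n => PowerSeries.coeff n (f (n + 1)))
  have : x - y = (x - evalPS ι τ hι hτ (f n)) - (y - evalPS ι τ hι hτ (f n)) := by ring
  rw [this]
  exact Valuation.map_sub_le _ (hf n) h2

end

/-! ### The coefficient rings `K[z_j | j ∈ J]` and the rings `D_J` as power series -/

section

variable {K : Type*} [Field K]

/-- For `m = deg P`, the element `Y ^ m * P(X/Y)` is a nonzero form of degree `m` in `X` and `Y`, so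
it has the same valuation as `Y ^ m`. -/
theorem v_aeval_X_div_Y {P : Polynomial K} (hP : P ≠ 0) :
    v K (Polynomial.aeval (X K / Y K) P) = 1 := by
  set m := P.natDegree with hm
  let F : PS K := ∑ k ∈ Finset.range (m + 1),
    MvPowerSeries.C (P.coeff k) * (MvPowerSeries.X 0 ^ k * MvPowerSeries.X 1 ^ (m - k))
  have hF : algebraMap (PS K) (E K) F = Y K ^ m * Polynomial.aeval (X K / Y K) P := by
    rw [Polynomial.aeval_eq_sum_range, map_sum, Finset.mul_sum]
    refine Finset.sum_congr rfl fun k hk => ?_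
    have hk' : k ≤ m := Nat.lt_succ_iff.1 (Finset.mem_range.1 hk)
    rw [map_mul, map_mul, map_pow, map_pow, Algebra.smul_def, div_pow]
    change _ * (X K ^ k * Y K ^ (m - k)) = _
    have h1 : algebraMap (PS K) (E K) (MvPowerSeries.C (P.coeff k)) =
        algebraMap K (E K) (P.coeff k) :=
      (IsScalarTower.algebraMap_apply K (PS K) (E K) _).symm
    have h2 : Y K ^ m = Y K ^ (m - k) * Y K ^ k := by rw [← pow_add, Nat.sub_add_cancel hk']
    have h3 : Y K ^ k ≠ 0 := pow_ne_zero _ Y_ne_zero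
    rw [h1, h2]
    field_simp
  -- The coefficient of `X ^ m` in `F` is the leading coefficient of `P`.
  have hcoeff : MvPowerSeries.coeff (Finsupp.single 0 m) F ≠ 0 := by
    have hterm : ∀ k ∈ Finset.range (m + 1), k ≠ m → MvPowerSeries.coeff (Finsupp.single 0 m)
        (MvPowerSeries.C (P.coeff k) *
          (MvPowerSeries.X 0 ^ k * MvPowerSeries.X 1 ^ (m - k)) : PS K) = 0 := by
      intro k hk hkm
      have hk' : k < m := lt_of_le_of_ne (Nat.lt_succ_iff.1 (Finset.mem_range.1 hk)) hkm
      rw [MvPowerSeries.coeff_C_mul, MvPowerSeries.X_pow_eq, MvPowerSeries.X_pow_eq,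
        MvPowerSeries.monomial_mul_monomial, MvPowerSeries.coeff_monomial_ne, mul_zero]
      intro h
      have := DFunLike.congr_fun h 1
      simp at this
      omega
    rw [map_sum, Finset.sum_eq_single_of_mem m (by simp) hterm, MvPowerSeries.coeff_C_mul,
      Nat.sub_self, pow_zero, mul_one, MvPowerSeries.X_pow_eq, MvPowerSeries.coeff_monomial_same,
      mul_one]
    simpa [hm] using hP
  have hF0 : F ≠ 0 := by
    intro h
    simp [h] at hcoeff
  have hle : F.order ≤ m := by
    simpa using MvPowerSeries.order_le hcoeff
  have hge : (m : ℕ∞) ≤ F.order := by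
    rw [← orderValuation_le_iff]
    refine Valuation.map_sum_le _ fun k hk => ?_
    have hk' : k ≤ m := Nat.lt_succ_iff.1 (Finset.mem_range.1 hk)
    rw [map_mul, map_mul, map_pow, map_pow, orderValuation_X, orderValuation_X, ← pow_add,
      Nat.add_sub_cancel' hk', ← WithZero.exp_nsmul]
    have h1 : orderValuation K (MvPowerSeries.C (P.coeff k)) ≤ 1 := by
      simpa using (orderValuation_le_iff (MvPowerSeries.C (P.coeff k) : PS K) 0).2 (by simp)
    simpa using mul_le_mul' h1 (le_refl (WithZero.exp (m • (-1 : ℤ))))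
  have hord : F.order = m := le_antisymm hle hge
  have hv := v_algebraMap F
  rw [hF, map_mul, map_pow, v_Y, orderValuation_apply_of_ne_zero K hF0, hord,
    ← WithZero.exp_nsmul, ENat.toNat_natCast, show m • (-1 : ℤ) = -(m : ℤ) by simp] at hv
  exact mul_left_cancel₀ WithZero.exp_ne_zero (hv.trans (mul_one _).symm)

open IntermediateField in
theorem v_eq_one_of_mem_adjoin {f : E K} (hf : f ∈ K⟮X K / Y K⟯) (hf0 : f ≠ 0) : v K f = 1 := by
  obtain ⟨r, s, rfl⟩ := (mem_adjoin_simple_iff K f).1 hf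
  have hr : r ≠ 0 := by
    rintro rfl
    simp at hf0
  have hs : s ≠ 0 := by
    rintro rfl
    simp at hf0
  rw [map_div₀, v_aeval_X_div_Y hr, v_aeval_X_div_Y hs, div_one]

/-- The linear form `X - aY`. -/
def linForm (a : K) : E K := X K - algebraMap K (E K) a * Y K

theorem linForm_eq (a : K) : linForm a = Y K * (X K / Y K - algebraMap K (E K) a) := by
  have := Y_ne_zero (K := K)
  rw [linForm]
  field_simp

theorem v_linForm (a : K) : v K (linForm a) = WithZero.exp (-1 : ℤ) := by
  have h := v_aeval_X_div_Y (Polynomial.X_sub_C_ne_zero a)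
  rw [map_sub, Polynomial.aeval_X, Polynomial.aeval_C] at h
  rw [linForm_eq, map_mul, h, v_Y, mul_one]

theorem linForm_ne_zero (a : K) : linForm a ≠ 0 := by
  intro h
  have := v_linForm a
  rw [h, map_zero] at this
  exact WithZero.exp_ne_zero this.symm

variable {I : Type*} (c : I → K)

theorem z_mul_linForm (i : I) : z c i * linForm (c i) = Y K :=
  div_mul_cancel₀ _ (linForm_ne_zero (c i))

theorem z_eq_inv (i : I) : z c i = (X K / Y K - algebraMap K (E K) (c i))⁻¹ := by
  have h := linForm_ne_zero (c i)
  have hY := Y_ne_zero (K := K)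
  rw [z]
  change Y K / linForm (c i) = _
  rw [linForm_eq] at h ⊢
  rw [div_mul_eq_div_div, div_self hY, one_div]

theorem X_div_Y_sub_ne_zero (a : K) : X K / Y K - algebraMap K (E K) a ≠ 0 := by
  intro h
  have := linForm_eq a
  rw [h, mul_zero] at this
  exact linForm_ne_zero a this

/-- The ring `K[z_j | j ∈ J]`. -/
def coefRing (J : Set I) : Subalgebra K (E K) := Algebra.adjoin K (z c '' J)

theorem coefRing_mono {J J' : Set I} (h : J ⊆ J') : coefRing c J ≤ coefRing c J' :=
  Algebra.adjoin_mono (Set.image_mono h)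

theorem z_mem_coefRing {J : Set I} {j : I} (hj : j ∈ J) : z c j ∈ coefRing c J :=
  Algebra.subset_adjoin ⟨j, hj, rfl⟩

open IntermediateField in
theorem coefRing_le (J : Set I) : coefRing c J ≤ K⟮X K / Y K⟯.toSubalgebra := by
  refine Algebra.adjoin_le ?_
  rintro _ ⟨j, -, rfl⟩
  rw [z_eq_inv]
  change _ ∈ K⟮X K / Y K⟯
  exact inv_mem (sub_mem (mem_adjoin_simple_self K _) (_root_.algebraMap_mem _ _))

theorem v_coefRing {J : Set I} (f : coefRing c J) (hf : f ≠ 0) : v K (f : E K) = 1 :=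
  v_eq_one_of_mem_adjoin (coefRing_le c J f.2) (by simpa using hf)

/-- The embedding of `K[z_j | j ∈ J]` in the completion of `E`. -/
def coefEmb (J : Set I) : coefRing c J →+* EHat K := (toEHat K).comp (coefRing c J).val.toRingHom

theorem coefEmb_apply {J : Set I} (f : coefRing c J) : coefEmb c J f = toEHat K f := rfl

theorem hatV_coefEmb {J : Set I} (f : coefRing c J) (hf : f ≠ 0) : hatV K (coefEmb c J f) = 1 := by
  rw [coefEmb_apply, hatV_toEHat, v_coefRing c f hf]

theorem hatV_coefEmb_le {J : Set I} (f : coefRing c J) : hatV K (coefEmb c J f) ≤ 1 := by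
  by_cases hf : f = 0
  · simp [hf]
  · exact (hatV_coefEmb c f hf).le

theorem hatV_linForm (a : K) : hatV K (toEHat K (linForm a)) = WithZero.exp (-1 : ℤ) := by
  rw [hatV_toEHat, v_linForm]

/-- The map `∑ f_n T ^ n ↦ ∑ f_n (X - aY) ^ n` on power series with coefficients in
`K[z_j | j ∈ J]`. -/
def evalLin (a : K) (J : Set I) : PowerSeries (coefRing c J) →+* EHat K :=
  evalPS (coefEmb c J) (toEHat K (linForm a)) (hatV_coefEmb_le c) (hatV_linForm a).le

theorem evalLin_injective (a : K) (J : Set I) : Function.Injective (evalLin c a J) :=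
  evalPS_injective _ _ (hatV_coefEmb c) (hatV_linForm a)

theorem evalLin_C (a : K) {J : Set I} (f : coefRing c J) :
    evalLin c a J (PowerSeries.C f) = toEHat K f :=
  evalPS_C _ _ _

theorem evalLin_X (a : K) (J : Set I) :
    evalLin c a J PowerSeries.X = toEHat K (linForm a) :=
  evalPS_X _ _

theorem evalLin_map_inclusion (a : K) {J J' : Set I} (h : J ⊆ J')
    (f : PowerSeries (coefRing c J)) :
    evalLin c a J' (f.map (Subalgebra.inclusion (coefRing_mono c h)).toRingHom) =
      evalLin c a J f := by
  refine IsValue.evalPS_eq _ _ fun n => ?_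
  obtain ⟨p, ⟨q, hq⟩, hp'⟩ := isValue_evalPS _ _ (hatV_coefEmb_le c) (hatV_linForm a).le f n
  refine ⟨p.map (Subalgebra.inclusion (coefRing_mono c h)).toRingHom,
    ⟨q.map (Subalgebra.inclusion (coefRing_mono c h)).toRingHom, ?_⟩, ?_⟩
  · rw [Polynomial.polynomial_map_coe, ← map_sub, hq, map_mul, map_pow, PowerSeries.map_X]
  · rw [Polynomial.eval₂_map]
    exact hp'

theorem linForm_mem_polyRing (a : K) (J : Set I) : linForm a ∈ polyRing c J := by
  refine sub_mem (Algebra.subset_adjoin (by simp))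
    (mul_mem (algebraMap_mem _ _) (Algebra.subset_adjoin (by simp)))

theorem coefRing_le_polyRing (J : Set I) : coefRing c J ≤ polyRing c J :=
  Algebra.adjoin_mono Set.subset_union_left

/-- No relation between `a` and `J` is needed; it is applied later with `a = c i` and `J = {i}ᶜ`. -/
theorem evalLin_mem_D (a : K) {J : Set I} (f : PowerSeries (coefRing c J)) :
    evalLin c a J f ∈ D c J := by
  change _ ∈ closure _
  rw [mem_closure_iff_hatV]
  intro n
  obtain ⟨p, -, hp⟩ := isValue_evalPS _ _ (hatV_coefEmb_le c) (hatV_linForm a).le f n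
  refine ⟨_, ?_, hp⟩
  rw [Polynomial.eval₂_eq_sum_range]
  refine sum_mem fun k _ => mul_mem ?_ (pow_mem ?_ k)
  · exact ⟨_, coefRing_le_polyRing c J (p.coeff k).2, rfl⟩
  · exact ⟨_, linForm_mem_polyRing c a J, rfl⟩

/-- The range is closed, so it suffices to reach the generators. With `z_i` among the coefficients,
`Y = z_i (X - c_i Y)` is a value, and then so is `X`. -/
theorem D_le_range_evalLin {J : Set I} {i : I} (hi : i ∈ J) :
    D c J ≤ (evalLin c (c i) J).range := by
  refine Subring.topologicalClosure_minimal _ ?_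
    (isClosed_range_evalPS _ _ (hatV_coefEmb c) (hatV_linForm (c i)))
  rintro _ ⟨f, hf, rfl⟩
  have hY : toEHat K (Y K) ∈ (evalLin c (c i) J).range :=
    ⟨PowerSeries.C ⟨z c i, z_mem_coefRing c hi⟩ * PowerSeries.X, by
      rw [map_mul, evalLin_C, evalLin_X, ← map_mul, z_mul_linForm]⟩
  have hC : ∀ a : K, toEHat K (algebraMap K (E K) a) ∈ (evalLin c (c i) J).range := fun a =>
    ⟨PowerSeries.C (algebraMap K _ a), evalLin_C _ _ _⟩
  change f ∈ Algebra.adjoin K _ at hf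
  induction hf using Algebra.adjoin_induction with
  | mem x hx =>
    rcases hx with ⟨j, hj, rfl⟩ | rfl | rfl
    · exact ⟨PowerSeries.C ⟨z c j, z_mem_coefRing c hj⟩, evalLin_C _ _ _⟩
    · have : X K = linForm (c i) + algebraMap K (E K) (c i) * Y K := by
        rw [linForm]
        ring
      rw [this, map_add, map_mul]
      exact add_mem ⟨PowerSeries.X, evalLin_X _ _ _⟩ (mul_mem (hC _) hY)
    · exact hY
  | algebraMap r => exact hC r
  | add x y _ _ hx hy => rw [map_add]; exact add_mem hx hy
  | mul x y _ _ hx hy => rw [map_mul]; exact mul_mem hx hy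

end

/-! ### Partial fractions, division and factorization recursions -/

section

section Generic

variable {K A I : Type*} [Field K] [CommRing A] [Algebra K A]

/-- A product `z i * z j` is a linear combination of its factors, so multiplication by the `z j`
with `j ∈ J` never creates higher powers of `z i`. -/
theorem mul_mem_adjoin_sup_span (z : I → A)
    (hz : ∀ j k, j ≠ k → ∃ a b : K, z j * z k = a • z j + b • z k) {i : I} {J : Set I}
    (hi : i ∉ J) {g : A} (hg : g ∈ Algebra.adjoin K (z '' J)) :
    z i * g ∈ Subalgebra.toSubmodule (Algebra.adjoin K (z '' J)) ⊔ Submodule.span K {z i} := by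
  have hzi : z i ∈ Subalgebra.toSubmodule (Algebra.adjoin K (z '' J)) ⊔ Submodule.span K {z i} :=
    Submodule.mem_sup_right (Submodule.mem_span_singleton_self _)
  have hl : ∀ x ∈ Algebra.adjoin K (z '' J),
      x ∈ Subalgebra.toSubmodule (Algebra.adjoin K (z '' J)) ⊔ Submodule.span K {z i} :=
    fun x hx => Submodule.mem_sup_left hx
  induction hg using Algebra.adjoin_induction with
  | mem x hx =>
    obtain ⟨j, hj, rfl⟩ := hx
    obtain ⟨a, b, hab⟩ := hz i j (fun h => hi (h ▸ hj))
    rw [hab]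
    exact add_mem (Submodule.smul_mem _ _ hzi)
      (Submodule.smul_mem _ _ (hl _ (Algebra.subset_adjoin ⟨j, hj, rfl⟩)))
  | algebraMap r =>
    rw [mul_comm, ← Algebra.smul_def]
    exact Submodule.smul_mem _ _ hzi
  | add x y _ _ hx hy => rw [mul_add]; exact add_mem hx hy
  | mul x y hxm hym hx hy =>
    obtain ⟨u, hu, w, hw, huw⟩ := Submodule.mem_sup.1 hx
    obtain ⟨k, rfl⟩ := Submodule.mem_span_singleton.1 hw
    rw [← mul_assoc, ← huw, add_mul, smul_mul_assoc]
    exact add_mem (hl _ (mul_mem ((Subalgebra.mem_toSubmodule _).1 hu) hym))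
      (Submodule.smul_mem _ _ hy)

theorem exists_add_of_mem_adjoin (z : I → A)
    (hz : ∀ j k, j ≠ k → ∃ a b : K, z j * z k = a • z j + b • z k) (i : I) {f : A}
    (hf : f ∈ Algebra.adjoin K (z '' Set.univ)) :
    ∃ g ∈ Algebra.adjoin K (z '' {i}ᶜ), ∃ h ∈ Algebra.adjoin K (z '' {i}), g + h = f := by
  let M := Subalgebra.toSubmodule (Algebra.adjoin K (z '' {i}ᶜ)) ⊔
    Subalgebra.toSubmodule (Algebra.adjoin K (z '' {i}))
  -- The sum `M` contains `1`, so it is enough that it is stable under multiplication by every `z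
  -- j`.
  suffices H : ∀ m ∈ M, f * m ∈ M by
    have := H 1 (Submodule.mem_sup_left (one_mem (Algebra.adjoin K (z '' {i}ᶜ))))
    rw [mul_one] at this
    exact Submodule.mem_sup.1 this
  have hmem : ∀ {J : Set I} {j : I}, j ∈ J → z j ∈ Algebra.adjoin K (z '' J) := fun {J j} hj =>
    Algebra.subset_adjoin ⟨j, hj, rfl⟩
  have hspan : ∀ {J : Set I} {j : I}, j ∈ J →
      Submodule.span K {z j} ≤ Subalgebra.toSubmodule (Algebra.adjoin K (z '' J)) := fun hj =>
    (Submodule.span_singleton_le_iff_mem _ _).2 (hmem hj)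
  induction hf using Algebra.adjoin_induction with
  | mem x hx =>
    obtain ⟨j, -, rfl⟩ := hx
    intro m hm
    obtain ⟨g, hg, h, hh, rfl⟩ := Submodule.mem_sup.1 hm
    rw [Subalgebra.mem_toSubmodule] at hg hh
    rw [mul_add]
    by_cases hj : j = i
    · subst hj
      refine add_mem ?_ (Submodule.mem_sup_right ?_)
      · exact sup_le_sup_left (hspan (Set.mem_singleton j)) _ (mul_mem_adjoin_sup_span z hz (by simp) hg)
      · exact (Subalgebra.mem_toSubmodule _).2 (mul_mem (hmem (Set.mem_singleton j)) hh)
    · refine add_mem (Submodule.mem_sup_left ?_) ?_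
      · exact (Subalgebra.mem_toSubmodule _).2 (mul_mem (hmem hj) hg)
      · have := mul_mem_adjoin_sup_span z hz (show j ∉ ({i} : Set I) from hj) hh
        rw [sup_comm] at this
        exact sup_le_sup_right (hspan hj) _ this
  | algebraMap r =>
    intro m hm
    rw [← Algebra.smul_def]
    exact Submodule.smul_mem _ _ hm
  | add x y _ _ hx hy => exact fun m hm => by rw [add_mul]; exact add_mem (hx m hm) (hy m hm)
  | mul x y _ _ hx hy => exact fun m hm => by rw [mul_assoc]; exact hx _ (hy m hm)

/-- An algebra of finite type that is integral over `K` is finite over `K`. -/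
theorem finite_quotient_of_isIntegral {s : Set A} (hs : s.Finite) (hA : Algebra.adjoin K s = ⊤)
    (J : Ideal A) (h : ∀ x ∈ s, IsIntegral K (Ideal.Quotient.mkₐ K J x)) :
    Module.Finite K (A ⧸ J) := by
  have h1 : Algebra.FiniteType K A := ⟨Subalgebra.fg_def.2 ⟨s, hs, hA⟩⟩
  have h2 : Algebra.FiniteType K (A ⧸ J) :=
    Algebra.FiniteType.of_surjective (Ideal.Quotient.mkₐ K J) (Ideal.Quotient.mkₐ_surjective K _)
  have h3 : Algebra.adjoin K s ≤ (integralClosure K (A ⧸ J)).comap (Ideal.Quotient.mkₐ K J) :=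
    Algebra.adjoin_le h
  have h4 : Algebra.IsIntegral K (A ⧸ J) := by
    refine ⟨fun x => ?_⟩
    obtain ⟨f, rfl⟩ := Ideal.Quotient.mkₐ_surjective K J x
    exact h3 (hA ▸ Algebra.mem_top)
  exact Algebra.IsIntegral.finite

theorem exists_remainders_of_finite (d : A) [Module.Finite K (A ⧸ Ideal.span {d})] :
    ∃ (m : ℕ) (e : Fin m → A), ∀ x : A, ∃ (q : A) (a : Fin m → K), x = d * q + ∑ k, a k • e k := by
  obtain ⟨m, s, hs⟩ := Module.Finite.exists_fin (R := K) (M := A ⧸ Ideal.span {d})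
  choose e he using fun k => Ideal.Quotient.mkₐ_surjective K (Ideal.span {d}) (s k)
  refine ⟨m, e, fun x => ?_⟩
  have hx : Ideal.Quotient.mkₐ K (Ideal.span {d}) x ∈ Submodule.span K (Set.range s) := by
    rw [hs]
    trivial
  obtain ⟨a, ha⟩ := (Submodule.mem_span_range_iff_exists_fun K).1 hx
  have h1 : Ideal.Quotient.mkₐ K (Ideal.span {d}) (x - ∑ k, a k • e k) = 0 := by
    rw [map_sub, map_sum, ← ha, sub_eq_zero]
    exact Finset.sum_congr rfl fun k _ => by rw [map_smul, he]
  rw [Ideal.Quotient.mkₐ_eq_mk, Ideal.Quotient.eq_zero_iff_mem, Ideal.mem_span_singleton] at h1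
  obtain ⟨q, hq⟩ := h1
  exact ⟨q, a, by rw [← hq, sub_add_cancel]⟩

end Generic

section PartialFractions

variable {K : Type*} [Field K] {I : Type*} (c : I → K)

theorem z_mul_z {i j : I} (h : c i ≠ c j) : z c i * z c j = (c i - c j)⁻¹ • (z c i - z c j) := by
  have hi := X_div_Y_sub_ne_zero (c i)
  have hj := X_div_Y_sub_ne_zero (c j)
  have hij : algebraMap K (E K) (c i) - algebraMap K (E K) (c j) ≠ 0 := by
    rw [← map_sub, Ne, map_eq_zero]
    exact sub_ne_zero.2 h
  rw [Algebra.smul_def, map_inv₀, map_sub, z_eq_inv, z_eq_inv]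
  field_simp
  ring

/-- Partial fractions: `K[z_j | j ∈ I] = K[z_j | j ≠ i] + K[z_i]`. -/
theorem exists_partialFractions (hc : Function.Injective c) (i : I) {f : E K}
    (hf : f ∈ coefRing c Set.univ) :
    ∃ g ∈ coefRing c {i}ᶜ, ∃ h ∈ coefRing c {i}, g + h = f :=
  exists_add_of_mem_adjoin (z c) (fun j k hjk => by
    exact ⟨(c j - c k)⁻¹, -(c j - c k)⁻¹, by
      rw [z_mul_z c (fun h => hjk (hc h)), smul_sub, neg_smul, sub_eq_add_neg]⟩) i hf

open IntermediateField in
theorem coefRing_le_adjoin_z (J : Set I) (j : I) : coefRing c J ≤ K⟮z c j⟯.toSubalgebra := by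
  have h : X K / Y K ∈ K⟮z c j⟯ := by
    have h1 : X K / Y K = (z c j)⁻¹ + algebraMap K (E K) (c j) := by
      rw [z_eq_inv, inv_inv, sub_add_cancel]
    rw [h1]
    exact add_mem (inv_mem (mem_adjoin_simple_self K _)) (_root_.algebraMap_mem _ _)
  exact (coefRing_le c J).trans (adjoin_simple_le_iff.2 h)

-- As `d ∈ K(z_j)`, write `d = r(z_j)/s(z_j)` with `r ≠ 0`. Then `r(z_j) = d * s(z_j)` vanishes
-- modulo `d`, so `r` witnesses algebraicity of the class of `z_j`.
open IntermediateField in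
theorem isIntegral_mk_z {d : coefRing c Set.univ} (hd : d ≠ 0) (j : I) :
    IsIntegral K (Ideal.Quotient.mk (Ideal.span {d})
      (⟨z c j, z_mem_coefRing c (Set.mem_univ j)⟩ : coefRing c Set.univ)) := by
  rw [← isAlgebraic_iff_isIntegral]
  have hd' : (d : E K) ≠ 0 := by simpa using hd
  obtain ⟨r, s, hrs⟩ := (mem_adjoin_simple_iff K _).1 (coefRing_le_adjoin_z c Set.univ j d.2)
  set ζ : coefRing c Set.univ := ⟨z c j, z_mem_coefRing c (Set.mem_univ j)⟩ with hζ
  have hs : Polynomial.aeval (z c j) s ≠ 0 := by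
    intro h
    rw [h, div_zero] at hrs
    exact hd' hrs
  have h1 : Polynomial.aeval ζ r = d * Polynomial.aeval ζ s := by
    apply Subtype.ext
    have h2 : ∀ p : Polynomial K, ((Polynomial.aeval ζ p : coefRing c Set.univ) : E K) =
        Polynomial.aeval (z c j) p := fun p => by
      rw [← Subalgebra.coe_val, ← Polynomial.aeval_algHom_apply]
      rfl
    rw [MulMemClass.coe_mul, h2, h2, hrs, div_mul_cancel₀ _ hs]
  refine ⟨r, ?_, ?_⟩
  · rintro rfl
    rw [map_zero, zero_div] at hrs
    exact hd' hrs
  · have h3 : Polynomial.aeval (Ideal.Quotient.mkₐ K (Ideal.span {d}) ζ) r = 0 := by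
      rw [Polynomial.aeval_algHom_apply, h1, Ideal.Quotient.mkₐ_eq_mk, Ideal.Quotient.eq_zero_iff_mem]
      exact Ideal.mul_mem_right _ _ (Ideal.mem_span_singleton_self d)
    exact h3

theorem exists_remainders [Finite I] {d : coefRing c Set.univ} (hd : d ≠ 0) :
    ∃ (m : ℕ) (e : Fin m → coefRing c Set.univ), ∀ x : coefRing c Set.univ,
      ∃ (q : coefRing c Set.univ) (a : Fin m → K), x = d * q + ∑ k, a k • e k := by
  have : Module.Finite K (coefRing c Set.univ ⧸ Ideal.span {d}) := by
    refine finite_quotient_of_isIntegral (s := ((↑) : coefRing c Set.univ → E K) ⁻¹'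
      (z c '' Set.univ)) ?_ (Algebra.adjoin_adjoin_coe_preimage) _ ?_
    · exact ((Set.toFinite Set.univ).image _).preimage Subtype.val_injective.injOn
    · rintro ⟨_, hx⟩ ⟨j, -, rfl⟩
      exact isIntegral_mk_z c hd j
  exact exists_remainders_of_finite d

end PartialFractions

section Recursion

/-- The quotient coefficients in the division of `f` by `d`, given a division `quo` by the constant
coefficient of `d`. -/
def divCoeff {R : Type*} [CommRing R] (d f : PowerSeries R) (quo : R → R) : ℕ → R
  | n => quo (PowerSeries.coeff n f -
      ∑ l : Fin n, divCoeff d f quo l * PowerSeries.coeff (n - l) d)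
termination_by n => n
decreasing_by exact l.2

/-- Division with remainder by a power series `d` follows from division with remainder by its
constant coefficient. -/
theorem exists_eq_mul_add_of_constantCoeff {R : Type*} [CommRing R] (d : PowerSeries R) (V : Set R)
    (h : ∀ x, ∃ q, ∃ r ∈ V, x = PowerSeries.constantCoeff d * q + r) (f : PowerSeries R) :
    ∃ q r, f = d * q + r ∧ ∀ n, PowerSeries.coeff n r ∈ V := by
  choose quo rem hrem heq using h
  let q : PowerSeries R := PowerSeries.mk (divCoeff d f quo)
  refine ⟨q, f - d * q, by ring, fun n => ?_⟩
  -- The `n`-th coefficient of `d * q` is a known sum plus `d 0 * q n`, and `q n` is chosen as the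
  -- quotient of what is left by `d 0`; only the remainder survives.
  suffices H : PowerSeries.coeff n (f - d * q) = rem (PowerSeries.coeff n f -
      ∑ l : Fin n, divCoeff d f quo l * PowerSeries.coeff (n - l) d) by
    rw [H]
    exact hrem _
  have h1 := heq (PowerSeries.coeff n f -
      ∑ l : Fin n, divCoeff d f quo l * PowerSeries.coeff (n - l) d)
  have h2 : PowerSeries.coeff n (d * q) =
      ∑ l : Fin n, divCoeff d f quo l * PowerSeries.coeff (n - l) d +
        divCoeff d f quo n * PowerSeries.constantCoeff d := by
    rw [mul_comm, PowerSeries.coeff_mul, Finset.Nat.sum_antidiagonal_eq_sum_range_succ_mk,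
      Finset.sum_range_succ, Finset.sum_range]
    simp [q]
  rw [map_sub, h2, ← sub_sub, sub_eq_iff_eq_add', mul_comm]
  conv_rhs => rw [divCoeff]
  exact h1

/-- The coefficients of the two factors in a factorization of a power series with constant
coefficient `1`, given an additive decomposition `m = s m + t m`. -/
def factorCoeff {M : Type*} [Ring M] (g : ℕ → M) (s t : M → M) : ℕ → M × M
  | 0 => (1, 1)
  | n + 1 =>
    let m := g (n + 1) - ∑ k : Fin n,
      (factorCoeff g s t (k + 1)).1 * (factorCoeff g s t (n - k)).2
    (s m, t m)
termination_by n => n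
decreasing_by
  · omega
  · omega

/-- A power series over a noncommutative ring, with constant coefficient `1`, factors along
every additive decomposition of the ring. -/
theorem exists_factorization {M : Type*} [Ring M] (A B : Set M)
    (h : ∀ m, ∃ a ∈ A, ∃ b ∈ B, a + b = m) (g : ℕ → M) (hg : g 0 = 1) :
    ∃ a b : ℕ → M, a 0 = 1 ∧ b 0 = 1 ∧ (∀ n, a (n + 1) ∈ A) ∧ (∀ n, b (n + 1) ∈ B) ∧
      ∀ n, g n = ∑ x ∈ Finset.HasAntidiagonal.antidiagonal n, a x.1 * b x.2 := by
  choose s hs t ht hst using h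
  refine ⟨fun n => (factorCoeff g s t n).1, fun n => (factorCoeff g s t n).2, ?_, ?_, ?_, ?_, ?_⟩
  · simp [factorCoeff]
  · simp [factorCoeff]
  · intro n
    change (factorCoeff g s t (n + 1)).1 ∈ A
    rw [factorCoeff]
    exact hs _
  · intro n
    change (factorCoeff g s t (n + 1)).2 ∈ B
    rw [factorCoeff]
    exact ht _
  · rintro (_ | n)
    · simp [factorCoeff, hg]
    -- Split off both end terms: as `a 0 = b 0 = 1` they are `a (n + 1)` and `b (n + 1)`, whose sum
    -- was chosen to be `g (n + 1)` minus the middle terms.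
    · rw [Finset.Nat.sum_antidiagonal_eq_sum_range_succ_mk, Finset.sum_range_succ,
        Finset.sum_range_succ', Finset.sum_range]
      have h0 : factorCoeff g s t 0 = (1, 1) := by rw [factorCoeff]
      have h1 := hst (g (n + 1) - ∑ k : Fin n,
        (factorCoeff g s t (k + 1)).1 * (factorCoeff g s t (n - k)).2)
      have h2 : factorCoeff g s t (n + 1) = (s (g (n + 1) - ∑ k : Fin n,
        (factorCoeff g s t (k + 1)).1 * (factorCoeff g s t (n - k)).2),
          t (g (n + 1) - ∑ k : Fin n,
        (factorCoeff g s t (k + 1)).1 * (factorCoeff g s t (n - k)).2)) := by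
        conv_lhs => rw [factorCoeff]
      simp only [Nat.sub_self, h0, one_mul, mul_one, Nat.sub_zero, Nat.add_sub_add_right, h2]
      rw [add_assoc, add_comm (t _), h1]
      abel

end Recursion

end

/-! ### Approximation of power series by elements of `E` -/

section

variable {K : Type*} [Field K]

/-- A series of power series with orders growing at least linearly converges. -/
theorem exists_sum_of_le_order (g : ℕ → PS K) (hg : ∀ n : ℕ, (n : ℕ∞) ≤ (g n).order) :
    ∃ s : PS K, ∀ n : ℕ, (n : ℕ∞) ≤ (s - ∑ k ∈ Finset.range n, g k).order := by
  -- Terms `g k` with `k > d.degree` have order too large to contribute to the coefficient at `d`.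
  let s : PS K := fun d => ∑ k ∈ Finset.range (d.degree + 1), MvPowerSeries.coeff d (g k)
  refine ⟨s, fun n => MvPowerSeries.nat_le_order fun d hd => ?_⟩
  have hs : MvPowerSeries.coeff d s =
      ∑ k ∈ Finset.range (d.degree + 1), MvPowerSeries.coeff d (g k) := rfl
  rw [map_sub, hs, map_sum, sub_eq_zero]
  refine Finset.sum_subset (Finset.range_mono hd) fun k _ hk => ?_
  have hk' : d.degree < k := by simpa using hk
  exact MvPowerSeries.coeff_of_lt_order (lt_of_lt_of_le (by exact_mod_cast hk') (hg k))

variable {I : Type*} (c : I → K)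

/-- With coefficients in `K`, the series `h(X - aY)` already converges in `K[[X, Y]]`. -/
theorem evalLin_map_algebraMap_mem_range (a : K) {J : Set I} (h : PowerSeries K) :
    evalLin c a J (h.map (algebraMap K (coefRing c J))) ∈ (toEHat K).range := by
  let l : PS K := MvPowerSeries.X 0 - MvPowerSeries.C a * MvPowerSeries.X 1
  have hC : ∀ r : K, algebraMap (PS K) (E K) (MvPowerSeries.C r) = algebraMap K (E K) r :=
    fun r => (IsScalarTower.algebraMap_apply K (PS K) (E K) r).symm
  have hl : algebraMap (PS K) (E K) l = linForm a := by
    rw [map_sub, map_mul, hC]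
    rfl
  have hord : ∀ n : ℕ, (n : ℕ∞) ≤ (MvPowerSeries.C (PowerSeries.coeff n h) * l ^ n).order := by
    intro n
    rw [← orderValuation_le_iff, map_mul, map_pow]
    have h1 : orderValuation K (MvPowerSeries.C (PowerSeries.coeff n h)) ≤ 1 := by
      simpa using
        (orderValuation_le_iff (MvPowerSeries.C (PowerSeries.coeff n h) : PS K) 0).2 (by simp)
    have h2 : orderValuation K l = WithZero.exp (-1 : ℤ) := by
      rw [← v_algebraMap, hl, v_linForm]
    rw [h2, ← WithZero.exp_nsmul]
    simpa using mul_le_mul' h1 (le_refl (WithZero.exp (n • (-1 : ℤ))))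
  obtain ⟨s, hs⟩ := exists_sum_of_le_order _ hord
  refine ⟨algebraMap (PS K) (E K) s, Eq.symm (IsValue.evalPS_eq _ _ fun n => ?_)⟩
  refine ⟨_, X_pow_dvd_sub_trunc _ n, ?_⟩
  have h1 : Polynomial.eval₂ (coefEmb c J) (toEHat K (linForm a))
      (PowerSeries.trunc n (h.map (algebraMap K (coefRing c J)))) =
      toEHat K (algebraMap (PS K) (E K) (∑ k ∈ Finset.range n,
        MvPowerSeries.C (PowerSeries.coeff k h) * l ^ k)) := by
    rw [PowerSeries.eval₂_trunc_eq_sum_range, map_sum, map_sum]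
    refine Finset.sum_congr rfl fun k _ => ?_
    rw [map_mul, map_mul, map_pow, map_pow, hl, hC, PowerSeries.coeff_map]
    rfl
  rw [h1, ← map_sub, ← map_sub, hatV_toEHat, v_algebraMap, orderValuation_le_iff]
  exact hs n

/-- Collecting coefficients along the finitely many `e k` gives `r = ∑ k, e k * h k` with each `h k`
a power series over `K`. -/
theorem evalLin_mem_range_of_coeff_mem_span (a : K) {J : Set I} {m : ℕ} (e : Fin m → coefRing c J)
    (r : PowerSeries (coefRing c J))
    (hr : ∀ n, ∃ b : Fin m → K, PowerSeries.coeff n r = ∑ k, b k • e k) :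
    evalLin c a J r ∈ (toEHat K).range := by
  choose b hb using hr
  have h : r = ∑ k, PowerSeries.C (e k) *
      (PowerSeries.mk fun n => b n k).map (algebraMap K (coefRing c J)) := by
    ext1 n
    rw [map_sum, hb]
    refine Finset.sum_congr rfl fun k _ => ?_
    rw [PowerSeries.coeff_C_mul, PowerSeries.coeff_map, PowerSeries.coeff_mk, Algebra.smul_def,
      mul_comm]
  rw [h, map_sum]
  refine sum_mem fun k _ => ?_
  rw [map_mul, evalLin_C]
  exact mul_mem ⟨_, rfl⟩ (evalLin_map_algebraMap_mem_range c a _)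

theorem evalLin_coe_mem_range (a : K) {J : Set I} (p : Polynomial (coefRing c J)) :
    evalLin c a J (p : PowerSeries (coefRing c J)) ∈ (toEHat K).range := by
  have h : evalLin c a J (p : PowerSeries (coefRing c J)) = _ := evalPS_coe _ _ p
  rw [h, Polynomial.eval₂_eq_sum_range]
  exact sum_mem fun k _ => mul_mem (RingHom.mem_range_self (toEHat K) _)
    (pow_mem (RingHom.mem_range_self (toEHat K) _) k)

/-- Modulo any nonzero power series, every power series is represented by an element of `E`. -/
theorem exists_approx [Finite I] (a : K) {δ : PowerSeries (coefRing c Set.univ)} (hδ : δ ≠ 0)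
    (f : PowerSeries (coefRing c Set.univ)) :
    ∃ g r, f = PowerSeries.X * δ * g + r ∧ evalLin c a Set.univ r ∈ (toEHat K).range := by
  set k := δ.order.toNat with hk
  obtain ⟨d, hd⟩ := PowerSeries.X_pow_order_dvd (φ := δ)
  rw [← hk] at hd
  have hd0 : PowerSeries.constantCoeff d ≠ 0 := by
    have := PowerSeries.coeff_order hδ
    rw [← hk] at this
    rw [hd, PowerSeries.coeff_X_pow_mul'] at this
    simpa using this
  obtain ⟨m, e, he⟩ := exists_remainders c hd0
  -- The truncation has its value in `E`. The rest is `X ^ (k + 1) * f'`, and `X ^ (k + 1) * d = X *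
  -- δ`, so dividing `f'` by `d` suffices.
  obtain ⟨f', hf'⟩ := X_pow_dvd_sub_trunc f (k + 1)
  obtain ⟨q, r, hqr, hr⟩ := exists_eq_mul_add_of_constantCoeff d
    {x | ∃ b : Fin m → K, x = ∑ l, b l • e l}
    (fun x => by obtain ⟨q, b, h⟩ := he x; exact ⟨q, _, ⟨b, rfl⟩, h⟩) f'
  refine ⟨q, (PowerSeries.trunc (k + 1) f : PowerSeries (coefRing c Set.univ)) +
    PowerSeries.X ^ (k + 1) * r, ?_, ?_⟩
  · rw [hqr] at hf'
    refine (sub_eq_iff_eq_add.1 hf').trans ?_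
    rw [hd]
    ring
  · rw [map_add, map_mul, map_pow, evalLin_X]
    exact add_mem (evalLin_coe_mem_range c a _)
      (mul_mem (pow_mem (RingHom.mem_range_self (toEHat K) _) _)
        (evalLin_mem_range_of_coeff_mem_span c a e r hr))

end

/-! ### Matrices: Cartan's lemma, approximation, common denominators -/

section

theorem exists_units_eq_of_map_constantCoeff_eq_one {A ι : Type*} [CommRing A] [Fintype ι]
    [DecidableEq ι] (g : Matrix ι ι (PowerSeries A)) (hg : g.map PowerSeries.constantCoeff = 1) :
    ∃ u : Matrix.GeneralLinearGroup ι (PowerSeries A), (u : Matrix ι ι (PowerSeries A)) = g := by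
  have h : IsUnit g := by
    rw [Matrix.isUnit_iff_isUnit_det, PowerSeries.isUnit_iff_constantCoeff, RingHom.map_det,
      RingHom.mapMatrix_apply, hg, Matrix.det_one]
    exact isUnit_one
  exact ⟨h.unit, rfl⟩

/-- Cartan's lemma: a matrix of power series congruent to `1` factors along every additive
decomposition `R = R₁ + R₂` of the coefficient ring. -/
theorem exists_matrix_factorization {R R₁ R₂ : Type*} [CommRing R] [CommRing R₁] [CommRing R₂]
    (ι₁ : R₁ →+* R) (ι₂ : R₂ →+* R) (h : ∀ x, ∃ p q, ι₁ p + ι₂ q = x) {n : ℕ}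
    (g : Matrix (Fin n) (Fin n) (PowerSeries R)) (hg : g.map PowerSeries.constantCoeff = 1) :
    ∃ (g₁ : Matrix (Fin n) (Fin n) (PowerSeries R₁))
      (g₂ : Matrix (Fin n) (Fin n) (PowerSeries R₂)),
      g₁.map PowerSeries.constantCoeff = 1 ∧ g₂.map PowerSeries.constantCoeff = 1 ∧
      g = g₁.map (PowerSeries.map ι₁) * g₂.map (PowerSeries.map ι₂) := by
  -- A matrix of power series is treated as a power series over the noncommutative matrix ring,
  -- whose additive decomposition is taken entrywise.
  obtain ⟨a, b, ha0, hb0, ha, hb, hab⟩ := exists_factorization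
    (Set.range fun m : Matrix (Fin n) (Fin n) R₁ => m.map ι₁)
    (Set.range fun m : Matrix (Fin n) (Fin n) R₂ => m.map ι₂)
    (fun m => by
      choose p q hpq using fun k l => h (m k l)
      refine ⟨_, ⟨Matrix.of p, rfl⟩, _, ⟨Matrix.of q, rfl⟩, ?_⟩
      ext k l
      exact hpq k l)
    (fun k => g.map (PowerSeries.coeff k))
    (by rw [← hg]; ext k l; simp)
  choose a' ha' using ha
  choose b' hb' using hb
  let a₁ : ℕ → Matrix (Fin n) (Fin n) R₁ := fun m => Nat.casesOn m 1 a'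
  let b₁ : ℕ → Matrix (Fin n) (Fin n) R₂ := fun m => Nat.casesOn m 1 b'
  have ha₁ : ∀ m, a m = (a₁ m).map ι₁ := by
    rintro (_ | m)
    · rw [ha0]
      exact (Matrix.map_one ι₁ (map_zero ι₁) (map_one ι₁)).symm
    · exact (ha' m).symm
  have hb₁ : ∀ m, b m = (b₁ m).map ι₂ := by
    rintro (_ | m)
    · rw [hb0]
      exact (Matrix.map_one ι₂ (map_zero ι₂) (map_one ι₂)).symm
    · exact (hb' m).symm
  refine ⟨Matrix.of fun k l => PowerSeries.mk fun m => a₁ m k l,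
    Matrix.of fun k l => PowerSeries.mk fun m => b₁ m k l, ?_, ?_, ?_⟩
  · ext k l
    rw [Matrix.map_apply, Matrix.of_apply, ← PowerSeries.coeff_zero_eq_constantCoeff_apply,
      PowerSeries.coeff_mk]
    rfl
  · ext k l
    rw [Matrix.map_apply, Matrix.of_apply, ← PowerSeries.coeff_zero_eq_constantCoeff_apply,
      PowerSeries.coeff_mk]
    rfl
  · refine Matrix.ext fun k l => PowerSeries.ext fun m => ?_
    have h1 : PowerSeries.coeff m (g k l) = (g.map (PowerSeries.coeff m)) k l := rfl
    rw [h1, hab m, Matrix.sum_apply, Matrix.mul_apply, map_sum]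
    simp_rw [Matrix.mul_apply, PowerSeries.coeff_mul]
    rw [Finset.sum_comm]
    refine Finset.sum_congr rfl fun p _ => Finset.sum_congr rfl fun x _ => ?_
    rw [Matrix.map_apply, Matrix.map_apply, PowerSeries.coeff_map, PowerSeries.coeff_map,
      Matrix.of_apply, Matrix.of_apply, PowerSeries.coeff_mk, PowerSeries.coeff_mk, ha₁, hb₁,
      Matrix.map_apply, Matrix.map_apply]

variable {K : Type*} [Field K] {I : Type*} (c : I → K)

/-- Every nonsingular matrix of power series becomes a matrix over `E` after multiplication by a
matrix congruent to `1`. -/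
theorem exists_matrix_approx [Finite I] (a : K) {n : ℕ}
    (B : Matrix (Fin n) (Fin n) (PowerSeries (coefRing c Set.univ))) (hB : B.det ≠ 0) :
    ∃ G : Matrix (Fin n) (Fin n) (PowerSeries (coefRing c Set.univ)),
      G.map PowerSeries.constantCoeff = 1 ∧
      ∃ A : Matrix (Fin n) (Fin n) (E K), (B * G).map (evalLin c a Set.univ) = A.map (toEHat K) := by
  choose g r hgr hr using fun k l => exists_approx c a hB (B k l)
  choose A hA using hr
  -- From `B = X * det B * g + r` and `B * adj B = det B`, this factor turns `B` into `r`; the extra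
  -- `X` in the modulus makes it congruent to `1`.
  refine ⟨1 - (PowerSeries.X : PowerSeries (coefRing c Set.univ)) • (B.adjugate * Matrix.of g),
    ?_, Matrix.of A, ?_⟩
  · ext1 k l
    rw [Matrix.map_apply, Matrix.sub_apply, Matrix.smul_apply, map_sub, smul_eq_mul, map_mul,
      PowerSeries.constantCoeff_X, zero_mul, sub_zero, Matrix.one_apply, Matrix.one_apply]
    split_ifs <;> simp
  · have h : B * (1 - (PowerSeries.X : PowerSeries (coefRing c Set.univ)) •
        (B.adjugate * Matrix.of g)) = Matrix.of r := by
      rw [mul_sub, mul_one, Matrix.mul_smul, ← mul_assoc, Matrix.mul_adjugate, smul_mul_assoc,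
        one_mul, smul_smul]
      ext1 k l
      rw [Matrix.sub_apply, Matrix.smul_apply, smul_eq_mul, Matrix.of_apply, Matrix.of_apply,
        sub_eq_iff_eq_add']
      exact hgr k l
    rw [h]
    ext k l
    exact (hA k l).symm

theorem D_mono {J J' : Set I} (h : J ⊆ J') : D c J ≤ D c J' := by
  have : polyRing c J ≤ polyRing c J' :=
    Algebra.adjoin_mono (Set.union_subset_union_left _ (Set.image_mono h))
  exact closure_mono (Set.image_mono this)

theorem D_le_Qi {i : I} {J : Set I} (h : i ∉ J) : D c J ≤ Qi c i := by
  have h1 : J ⊆ {i}ᶜ := fun j hj hji => h (Set.mem_singleton_iff.1 hji ▸ hj)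
  exact (D_mono c h1).trans le_sup_right

theorem D_singleton_le_Qi' (i : I) : D c {i} ≤ Qi' c i := by
  refine le_inf ?_ (le_iInf₂ fun j hj => D_le_Qi c hj)
  exact (D_mono c (Set.subset_univ _)).trans fun x hx => Subfield.subset_closure hx

theorem exists_fraction (i : I) {x : EHat K} (hx : x ∈ Q c) :
    ∃ p q : PowerSeries (coefRing c Set.univ), q ≠ 0 ∧
      evalLin c (c i) Set.univ q * x = evalLin c (c i) Set.univ p := by
  have hle : Subring.closure (D c Set.univ : Set (EHat K)) ≤ (evalLin c (c i) Set.univ).range :=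
    Subring.closure_le.2 (D_le_range_evalLin c (Set.mem_univ i))
  obtain ⟨y, hy, w, hw, rfl⟩ := Subfield.mem_closure_iff.1 hx
  obtain ⟨p, rfl⟩ := hle hy
  obtain ⟨q, rfl⟩ := hle hw
  -- If the denominator vanishes, the quotient is `0` by convention and is represented by `0 / 1`.
  by_cases hq : q = 0
  · exact ⟨0, 1, one_ne_zero, by simp [hq]⟩
  · refine ⟨p, q, hq, mul_div_cancel₀ _ ?_⟩
    exact (map_ne_zero_iff _ (evalLin_injective c (c i) Set.univ)).2 hq

theorem exists_common_denominator (i : I) {n : ℕ} (b : Matrix (Fin n) (Fin n) (EHat K))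
    (hb : ∀ k l, b k l ∈ Q c) :
    ∃ (d : PowerSeries (coefRing c Set.univ))
      (B : Matrix (Fin n) (Fin n) (PowerSeries (coefRing c Set.univ))), d ≠ 0 ∧
      evalLin c (c i) Set.univ d • b = B.map (evalLin c (c i) Set.univ) := by
  choose p q hq hpq using fun x : Fin n × Fin n => exists_fraction c i (hb x.1 x.2)
  refine ⟨∏ x, q x, Matrix.of fun k l => p (k, l) * ∏ x ∈ Finset.univ.erase (k, l), q x,
    Finset.prod_ne_zero_iff.2 fun x _ => hq x, ?_⟩
  ext k l
  rw [Matrix.smul_apply, Matrix.map_apply, Matrix.of_apply, smul_eq_mul,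
    ← Finset.mul_prod_erase Finset.univ q (Finset.mem_univ (k, l)), map_mul, map_mul, ← hpq (k, l)]
  ring

end

/-! ### Factorization of matrices over `Q` -/

section

variable {K : Type*} [Field K] {I : Type*} (c : I → K)

/-- A matrix over the field `Q` is the product of a matrix over `E` and of the value of a matrix of
power series congruent to `1`. -/
theorem exists_eq_map_toEHat_mul [Finite I] (i : I) {n : ℕ}
    (b : Matrix.GeneralLinearGroup (Fin n) (EHat K)) (hb : ∀ k l, b k l ∈ Q c) :
    ∃ (x : Matrix.GeneralLinearGroup (Fin n) (E K))
      (H : Matrix (Fin n) (Fin n) (PowerSeries (coefRing c Set.univ))),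
      H.map PowerSeries.constantCoeff = 1 ∧
      (b : Matrix (Fin n) (Fin n) (EHat K)) =
        (x : Matrix (Fin n) (Fin n) (E K)).map (toEHat K) *
          H.map (evalLin c (c i) Set.univ) := by
  obtain ⟨d, B, hd, hB⟩ := exists_common_denominator c i (b : Matrix (Fin n) (Fin n) (EHat K)) hb
  have hinj := evalLin_injective c (c i) Set.univ
  set φ := evalLin c (c i) Set.univ with hφ
  have hφd : φ d ≠ 0 := (map_ne_zero_iff _ hinj).2 hd
  have hbdet : (b : Matrix (Fin n) (Fin n) (EHat K)).det ≠ 0 := b.det_ne_zero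
  have hBdet : B.det ≠ 0 := by
    intro h
    have h1 : (φ.mapMatrix B).det = 0 := by rw [← RingHom.map_det, h, map_zero]
    rw [RingHom.mapMatrix_apply, ← hB, Matrix.det_smul] at h1
    exact mul_ne_zero (pow_ne_zero _ hφd) hbdet h1
  obtain ⟨G, hG, A, hA⟩ := exists_matrix_approx c (c i) B hBdet
  obtain ⟨u, rfl⟩ := exists_units_eq_of_map_constantCoeff_eq_one G hG
  -- Approximating `d` modulo `X * d` itself gives `r = d * (1 - X * g)` with value `a` in `E`, so
  -- dividing by `d` amounts to dividing by `a` and multiplying by `1 - X * g`.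
  obtain ⟨g, r, hgr, a, ha⟩ := exists_approx c (c i) hd d
  have hr : r = d * (1 - PowerSeries.X * g) := by
    rw [mul_sub, mul_one, eq_sub_iff_add_eq, add_comm]
    refine Eq.trans ?_ hgr.symm
    ring
  have hg0 : (1 - PowerSeries.X * g) ≠ 0 := by
    intro h
    have := congrArg PowerSeries.constantCoeff h
    simp at this
  have ha0 : a ≠ 0 := by
    rintro rfl
    rw [map_zero, eq_comm, map_eq_zero_iff _ hinj, hr] at ha
    exact mul_ne_zero hd hg0 ha
  have hAdet : A.det ≠ 0 := by
    intro h
    have h1 : ((toEHat K).mapMatrix A).det = 0 := by rw [← RingHom.map_det, h, map_zero]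
    rw [RingHom.mapMatrix_apply, ← hA, ← RingHom.mapMatrix_apply, ← RingHom.map_det,
      map_eq_zero_iff _ hinj, Matrix.det_mul] at h1
    exact mul_ne_zero hBdet ((Matrix.isUnit_iff_isUnit_det _).1 u.isUnit).ne_zero h1
  have hxdet : (a⁻¹ • A).det ≠ 0 := by
    rw [Matrix.det_smul]
    exact mul_ne_zero (pow_ne_zero _ (inv_ne_zero ha0)) hAdet
  refine ⟨Matrix.GeneralLinearGroup.mkOfDetNeZero _ hxdet,
    (1 - PowerSeries.X * g) • ((u⁻¹ : Matrix.GeneralLinearGroup _ _) :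
      Matrix (Fin n) (Fin n) (PowerSeries (coefRing c Set.univ))), ?_, ?_⟩
  · have h1 : ((u⁻¹ : Matrix.GeneralLinearGroup _ _) :
        Matrix (Fin n) (Fin n) (PowerSeries (coefRing c Set.univ))).map
          PowerSeries.constantCoeff = 1 := by
      have h2 := congrArg (PowerSeries.constantCoeff (R := coefRing c Set.univ)).mapMatrix
        (Units.mul_inv u)
      rw [map_mul, map_one, RingHom.mapMatrix_apply, hG, one_mul] at h2
      exact h2
    rw [← h1]
    ext1 k l
    simp
  · have h1 : (toEHat K a)⁻¹ * φ (1 - PowerSeries.X * g) = (φ d)⁻¹ := by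
      have h2 : toEHat K a = φ d * φ (1 - PowerSeries.X * g) := by rw [ha, hr, map_mul]
      have h3 : φ (1 - PowerSeries.X * g) ≠ 0 := (map_ne_zero_iff _ hinj).2 hg0
      rw [h2, mul_inv, mul_assoc, inv_mul_cancel₀ h3, mul_one]
    have h2 : A.map (toEHat K) * ((u⁻¹ : Matrix.GeneralLinearGroup _ _) :
        Matrix (Fin n) (Fin n) (PowerSeries (coefRing c Set.univ))).map φ = B.map φ := by
      rw [← hA, ← Matrix.map_mul, mul_assoc, Units.mul_inv, mul_one]
    have h3 : (a⁻¹ • A).map (toEHat K) = (toEHat K a)⁻¹ • A.map (toEHat K) := by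
      ext k l
      simp
    have h4 : ∀ (f : PowerSeries (coefRing c Set.univ))
        (M : Matrix (Fin n) (Fin n) (PowerSeries (coefRing c Set.univ))),
        (f • M).map φ = φ f • M.map φ := by
      intro f M
      ext k l
      simp
    change _ = (a⁻¹ • A).map (toEHat K) * _
    rw [h3, h4, smul_mul_assoc, Matrix.mul_smul, h2, smul_smul, h1, ← hB, smul_smul,
      inv_mul_cancel₀ hφd, one_smul]

/-- The matrix over `E` and the left Cartan factor are both absorbed into `b₁`, as `Q_i` contains
`E` and `D_{I∖{i}}`; the right Cartan factor is `b₂`. -/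
theorem exists_factorization_Qi [Finite I] (hc : Function.Injective c) (i : I) {n : ℕ}
    (b : Matrix.GeneralLinearGroup (Fin n) (EHat K)) (hb : ∀ k l, b k l ∈ Q c) :
    ∃ (b₁ : Matrix.GeneralLinearGroup (Fin n) (Qi c i))
      (b₂ : Matrix.GeneralLinearGroup (Fin n) (Qi' c i)),
      b = Matrix.GeneralLinearGroup.map (Qi c i).subtype b₁ *
        Matrix.GeneralLinearGroup.map (Qi' c i).subtype b₂ := by
  obtain ⟨x, H, hH, hbx⟩ := exists_eq_map_toEHat_mul c i b hb
  obtain ⟨g₁, g₂, hg₁, hg₂, hg⟩ := exists_matrix_factorization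
    (Subalgebra.inclusion (coefRing_mono c (Set.subset_univ {i}ᶜ))).toRingHom
    (Subalgebra.inclusion (coefRing_mono c (Set.subset_univ {i}))).toRingHom
    (fun f => by
      obtain ⟨p, hp, q, hq, hpq⟩ := exists_partialFractions c hc i f.2
      exact ⟨⟨p, hp⟩, ⟨q, hq⟩, Subtype.ext hpq⟩) H hH
  obtain ⟨u₁, rfl⟩ := exists_units_eq_of_map_constantCoeff_eq_one g₁ hg₁
  obtain ⟨u₂, rfl⟩ := exists_units_eq_of_map_constantCoeff_eq_one g₂ hg₂
  let ε : E K →+* Qi c i := (toEHat K).codRestrict _ fun e =>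
    (le_sup_left : (toEHat K).range ≤ Qi c i) ⟨e, rfl⟩
  let ψ₁ : PowerSeries (coefRing c {i}ᶜ) →+* Qi c i :=
    (evalLin c (c i) {i}ᶜ).codRestrict _ fun f =>
      D_le_Qi c (by simp : i ∉ ({i}ᶜ : Set I)) (evalLin_mem_D c (c i) f)
  let ψ₂ : PowerSeries (coefRing c {i}) →+* Qi' c i :=
    (evalLin c (c i) {i}).codRestrict _ fun f =>
      D_singleton_le_Qi' c i (evalLin_mem_D c (c i) f)
  refine ⟨Matrix.GeneralLinearGroup.map ε x * Matrix.GeneralLinearGroup.map ψ₁ u₁,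
    Matrix.GeneralLinearGroup.map ψ₂ u₂, ?_⟩
  have h₁ : ∀ f, evalLin c (c i) Set.univ (PowerSeries.map (Subalgebra.inclusion
      (coefRing_mono c (Set.subset_univ {i}ᶜ))).toRingHom f) = evalLin c (c i) {i}ᶜ f :=
    evalLin_map_inclusion c (c i) (Set.subset_univ _)
  have h₂ : ∀ f, evalLin c (c i) Set.univ (PowerSeries.map (Subalgebra.inclusion
      (coefRing_mono c (Set.subset_univ {i}))).toRingHom f) = evalLin c (c i) {i} f :=
    evalLin_map_inclusion c (c i) (Set.subset_univ _)
  rw [map_mul]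
  apply Units.ext
  rw [hbx, hg, Matrix.map_mul, ← mul_assoc]
  rw [Units.val_mul, Units.val_mul]
  refine congrArg₂ (· * ·) (congrArg₂ (· * ·) ?_ ?_) ?_
  · rfl
  · ext k l
    exact h₁ _
  · ext k l
    exact h₂ _

end

end AnalyticPatching

end

theorem proposition1p14 {K : Type*} [Field K] [Infinite K] {I : Type*} [Finite I] (c : I → K)
    (hc : Function.Injective c) (i : I) (n : ℕ)
    (b : Matrix.GeneralLinearGroup (Fin n) (AnalyticPatching.Q c)) :
    ∃ (b₁ : Matrix.GeneralLinearGroup (Fin n) (AnalyticPatching.Qi c i))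
      (b₂ : Matrix.GeneralLinearGroup (Fin n) (AnalyticPatching.Qi' c i)),
      Matrix.GeneralLinearGroup.map (AnalyticPatching.Q c).subtype b =
        Matrix.GeneralLinearGroup.map (AnalyticPatching.Qi c i).subtype b₁ *
          Matrix.GeneralLinearGroup.map (AnalyticPatching.Qi' c i).subtype b₂ :=
  AnalyticPatching.exists_factorization_Qi c hc i _ fun k l => (b k l).2
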